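/- Let $p:\widetilde{PSL_2\mathbb R}\to PSL_2\mathbb R=\mathrm{Isom}^+(\mathbb H^2)$ be the universal covering group, whose elements are the homotopy classes (relative to endpoints) of paths in $PSL_2\mathbb R$ starting at $1$, and let $\mathbf z$ be the class of the path of anticlockwise rotations through angle $2\pi t$, $0\le t\le 1$, about a point of $\mathbb H^2$. Let $\mathrm{Hyp}_0$ be the set of classes of paths $t\mapsto c(t)$, $0\le t\le1$, where for some geodesic and some $d>0$ the isometry $c(t)$ is the translation through distance $td$ along that (oriented) geodesic. Let $\mathrm{Par}_0^+$ (resp. $\mathrm{Par}_0^-$) be the set of classes of paths $t\mapsto c(t)$, $0\le t\le1$, where in some orientation-preserving identification of $\mathbb H^2$ with the upper half plane $c(t)$ is $w\mapsto w+ts$ with $s>0$ (resp. $s<0$), so that $c(1)$ is a parabolic moving the circle at infinity anticlockwise (resp. clockwise). Put $\mathrm{Par}_0=\mathrm{Par}_0^+\cup\mathrm{Par}_0^-$, $\mathrm{Hyp}_n=\mathbf z^n\,\mathrm{Hyp}_0$ and $\mathrm{Par}_n^{\pm}=\mathbf z^n\,\mathrm{Par}_0^{\pm}$ for $n\in\mathbb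 Z$. Let $\mathrm{Ell}_1$ (resp. $\mathrm{Ell}_{-1}$) be the set of classes of paths of rotations through the angle $t\varphi$, $0\le t\le1$, about a fixed point of $\mathbb H^2$, with $\varphi\in(0,2\pi)$ (resp. $\varphi\in(-2\pi,0)$), angles being measured anticlockwise. Since $\widetilde{PSL_2\mathbb R}$ covers $SL_2\mathbb R$, there is a trace $\mathrm{Tr}$ on $\widetilde{PSL_2\mathbb R}$. Let $\alpha,\beta\in PSL_2\mathbb R$, let $\tilde\alpha,\tilde\beta\in\widetilde{PSL_2\mathbb R}$ be any lifts of $\alpha,\beta$, and let $[\tilde\alpha,\tilde\beta]=\tilde\alpha\tilde\beta\tilde\alpha^{-1}\tilde\beta^{-1}$ (this does not depend on the choice of lifts). Then: 1. if $\mathrm{Tr}[\tilde\alpha,\tilde\beta]>2$, then $[\tilde\alpha,\tilde\beta]\in\mathrm{Hyp}_0$; 2. if $\mathrm{Tr}[\tilde\alpha,\tilde\beta]=2$, then $[\tilde\alpha,\tilde\beta]\in\{1\}\cup\mathrm{Par}_0$; 3. if $\mathrm{Tr}[\tilde\alpha,\tilde\beta]\in(-2,2)$, then $[\tilde\alpha,\tilde\beta]\in\mathrm{Ell}_{-1}\cup\mathrm{Ell}_1$;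 4. if $\mathrm{Tr}[\tilde\alpha,\tilde\beta]=-2$, then $[\tilde\alpha,\tilde\beta]\in\mathrm{Par}_{-1}^+\cup\mathrm{Par}_1^-$; 5. if $\mathrm{Tr}[\tilde\alpha,\tilde\beta]<-2$, then $[\tilde\alpha,\tilde\beta]\in\mathrm{Hyp}_{-1}\cup\mathrm{Hyp}_1$. -/

import Mathlib

open scoped MatrixGroups unitInterval commutatorElement

noncomputable section

/-! ### The universal covering group as homotopy classes of paths -/

/-- The group, under pointwise multiplication, of paths `[0,1] → G` starting at `1`. -/
def pathsFromOne (G : Type*) [Group G] [TopologicalSpace G] [IsTopologicalGroup G] :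
    Subgroup C(I, G) where
  carrier := {γ | γ 0 = 1}
  mul_mem' := by
    intro a b ha hb
    simp only [Set.mem_ofPred_eq] at ha hb ⊢
    simp [ha, hb]
  one_mem' := by simp
  inv_mem' := by
    intro a ha
    simp only [Set.mem_ofPred_eq] at ha ⊢
    simp [ha]

/-- Homotopy of paths relative to their endpoints, as a congruence relation on the group of paths
starting at `1`. -/
def homotopyCon (G : Type*) [Group G] [TopologicalSpace G] [IsTopologicalGroup G] :
    Con (pathsFromOne G) where
  r γ δ := ContinuousMap.HomotopicRel (γ : C(I, G)) (δ : C(I, G)) {0, 1}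
  iseqv :=
    ⟨fun _ => ContinuousMap.HomotopicRel.refl _, fun h => h.symm, fun h h' => h.trans h'⟩
  mul' := by
    rintro a b c d ⟨F⟩ ⟨H⟩
    refine ⟨⟨⟨⟨fun p => F p * H p, by fun_prop⟩, fun x => ?_, fun x => ?_⟩, fun t x hx => ?_⟩⟩
    · simp
    · simp
    · have h1 := F.eq_fst t hx
      have h2 := H.eq_fst t hx
      simp [h1, h2]

/-- The universal covering group of a (nice, connected) topological group `G`: homotopy classes,
relative to endpoints, of paths starting at `1`, multiplied pointwise. -/
abbrev UnivCover (G : Type*) [Group G] [TopologicalSpace G] [IsTopologicalGroup G] : Type _ :=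
  (homotopyCon G).Quotient

/-- The element of the universal cover represented by a path starting at `1`. -/
def UnivCover.mk {G : Type*} [Group G] [TopologicalSpace G] [IsTopologicalGroup G]
    (γ : C(I, G)) (h : γ 0 = 1) : UnivCover G :=
  ((⟨γ, h⟩ : pathsFromOne G) : (homotopyCon G).Quotient)

/-- The covering homomorphism: a homotopy class of paths is sent to the common endpoint. -/
def UnivCover.proj {G : Type*} [Group G] [TopologicalSpace G] [IsTopologicalGroup G] :
    UnivCover G →* G :=
  (homotopyCon G).lift
    { toFun := fun γ => (γ : C(I, G)) 1
      map_one' := rfl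
      map_mul' := fun _ _ => rfl }
    (fun _ _ h => ContinuousMap.HomotopicRel.fst_eq_snd h (by simp))

/-! ### The universal cover of `PSL(2, ℝ)` and the trace on it -/

/-- The universal covering group of `PSL(2, ℝ)`. -/
abbrev PSLTilde : Type := UnivCover PSL(2, ℝ)

/-- The quotient homomorphism `SL(2, ℝ) → PSL(2, ℝ)`. -/
def toPSL : SL(2, ℝ) →* PSL(2, ℝ) := QuotientGroup.mk' _

theorem continuous_toPSL : Continuous toPSL := continuous_quot_mk

theorem isCoveringMap_toPSL : IsCoveringMap toPSL := by
  have hfin : (Subgroup.center SL(2, ℝ) : Set SL(2, ℝ)).Finite := by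
    refine Set.Finite.subset (Set.toFinite {(1 : SL(2, ℝ)), -1}) fun A hA => ?_
    obtain ⟨r, hr, hrA⟩ := Matrix.SpecialLinearGroup.mem_center_iff.mp hA
    have h2 : r = 1 ∨ r = -1 := by simpa using hr
    rcases h2 with rfl | rfl
    · left
      ext i j
      rw [← hrA]
      simp
    · right
      ext i j
      rw [← hrA]
      fin_cases i <;> fin_cases j <;> simp
  have hdisc : IsDiscrete (Subgroup.center SL(2, ℝ) : Set SL(2, ℝ)) := hfin.isDiscrete
  exact (Subgroup.isQuotientCoveringMap _ hdisc).isCoveringMap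

/-- The covering map from the universal cover of `PSL(2, ℝ)` to `SL(2, ℝ)`: lift a path in
`PSL(2, ℝ)` starting at `1` to the path in `SL(2, ℝ)` starting at `1`, and take its endpoint. -/
def toSL : PSLTilde → SL(2, ℝ) :=
  Quotient.lift
    (fun γ : pathsFromOne PSL(2, ℝ) =>
      isCoveringMap_toPSL.liftPath (γ : C(I, PSL(2, ℝ))) 1 (by rw [γ.2, map_one]) 1)
    (fun γ _ h => isCoveringMap_toPSL.liftPath_apply_one_eq_of_homotopicRel h 1
      (by rw [γ.2, map_one]) _)

/-- The trace on the universal cover of `PSL(2, ℝ)`, through the covering of `SL(2, ℝ)`. -/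
def traceTilde (x : PSLTilde) : ℝ := (toSL x : Matrix (Fin 2) (Fin 2) ℝ).trace

/-! ### Model one-parameter groups of isometries of the upper half plane -/

/-- `z ↦ exp d • z`: the hyperbolic translation through signed distance `d` along the geodesic
from `0` to `∞`. -/
def dilationSL (d : ℝ) : SL(2, ℝ) :=
  ⟨!![Real.exp (d / 2), 0; 0, Real.exp (-(d / 2))], by
    simp [Matrix.det_fin_two, ← Real.exp_add]⟩

/-- `z ↦ z + s`: the parabolic translation along the horocycles at `∞`. It moves the circle at
infinity (oriented as the boundary of the upper half plane, that is, by increasing real part)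
anticlockwise if `0 < s` and clockwise if `s < 0`. -/
def shiftSL (s : ℝ) : SL(2, ℝ) :=
  ⟨!![1, s; 0, 1], by simp [Matrix.det_fin_two]⟩

/-- The anticlockwise rotation through the angle `φ` about the point `i` of the upper half plane;
its derivative at `i` is `exp (i φ)`. -/
def rotationSL (φ : ℝ) : SL(2, ℝ) :=
  ⟨!![Real.cos (φ / 2), Real.sin (φ / 2); -Real.sin (φ / 2), Real.cos (φ / 2)], by
    simp [Matrix.det_fin_two, ← sq]⟩

theorem continuous_dilationSL : Continuous dilationSL := by
  refine Continuous.subtype_mk (continuous_matrix fun i j => ?_) _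
  fin_cases i <;> fin_cases j <;> simp <;> fun_prop

theorem continuous_shiftSL : Continuous shiftSL := by
  refine Continuous.subtype_mk (continuous_matrix fun i j => ?_) _
  fin_cases i <;> fin_cases j <;> simp <;> fun_prop

theorem continuous_rotationSL : Continuous rotationSL := by
  refine Continuous.subtype_mk (continuous_matrix fun i j => ?_) _
  fin_cases i <;> fin_cases j <;> simp <;> fun_prop

theorem dilationSL_zero : dilationSL 0 = 1 := by
  ext i j
  fin_cases i <;> fin_cases j <;> simp [dilationSL]

theorem shiftSL_zero : shiftSL 0 = 1 := by
  ext i j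
  fin_cases i <;> fin_cases j <;> simp [shiftSL]

theorem rotationSL_zero : rotationSL 0 = 1 := by
  ext i j
  fin_cases i <;> fin_cases j <;> simp [rotationSL]

/-! ### Lifts to the universal cover -/

/-- The simplest lift of the hyperbolic translation through distance `d` along the axis from
`P • 0` to `P • ∞`: the class of the path of translations through distance `t d`, `0 ≤ t ≤ 1`,
along that axis. -/
def hypLift (P : SL(2, ℝ)) (d : ℝ) : PSLTilde :=
  UnivCover.mk
    ⟨fun t : I => toPSL (P * dilationSL (t * d) * P⁻¹), continuous_toPSL.comp
      ((continuous_const.mul (continuous_dilationSL.comp (by fun_prop))).mul continuous_const)⟩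
    (by simp [dilationSL_zero])

/-- The simplest lift of the parabolic fixing `P • ∞` which is conjugate by `P` to `z ↦ z + s`:
the class of the path of parabolics conjugate by `P` to `z ↦ z + t s`, `0 ≤ t ≤ 1`. -/
def parLift (P : SL(2, ℝ)) (s : ℝ) : PSLTilde :=
  UnivCover.mk
    ⟨fun t : I => toPSL (P * shiftSL (t * s) * P⁻¹), continuous_toPSL.comp
      ((continuous_const.mul (continuous_shiftSL.comp (by fun_prop))).mul continuous_const)⟩
    (by simp [shiftSL_zero])

/-- The rotation about `P • i` through the (real) angle `φ`, anticlockwise if `0 < φ`: the class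
of the path of rotations about `P • i` through angle `t φ`, `0 ≤ t ≤ 1`. -/
def rotLift (P : SL(2, ℝ)) (φ : ℝ) : PSLTilde :=
  UnivCover.mk
    ⟨fun t : I => toPSL (P * rotationSL (t * φ) * P⁻¹), continuous_toPSL.comp
      ((continuous_const.mul (continuous_rotationSL.comp (by fun_prop))).mul continuous_const)⟩
    (by simp [rotationSL_zero])

/-- The generator of the lifts of the identity: one full anticlockwise turn of the tangent plane
at a point. -/
def zTilde : PSLTilde := rotLift 1 (2 * Real.pi)

/-! ### Regions of the universal cover -/

/-- `Hyp n = z ^ n Hyp 0`, where `Hyp 0` is the set of simplest lifts of hyperbolics. -/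
def Hyp (n : ℤ) : Set PSLTilde :=
  {x | ∃ (P : SL(2, ℝ)) (d : ℝ), 0 < d ∧ x = zTilde ^ n * hypLift P d}

/-- `ParPlus n = z ^ n ParPlus 0`, where `ParPlus 0` is the set of simplest lifts of
anticlockwise parabolics. -/
def ParPlus (n : ℤ) : Set PSLTilde :=
  {x | ∃ (P : SL(2, ℝ)) (s : ℝ), 0 < s ∧ x = zTilde ^ n * parLift P s}

/-- `ParMinus n = z ^ n ParMinus 0`, where `ParMinus 0` is the set of simplest lifts of clockwise
parabolics. -/
def ParMinus (n : ℤ) : Set PSLTilde :=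
  {x | ∃ (P : SL(2, ℝ)) (s : ℝ), s < 0 ∧ x = zTilde ^ n * parLift P s}

/-- `Par n = z ^ n Par 0`, where `Par 0` is the set of simplest lifts of parabolics. -/
def Par (n : ℤ) : Set PSLTilde := ParPlus n ∪ ParMinus n

/-- The simplest anticlockwise lifts of elliptics: rotations through an angle in `(0, 2π)`. -/
def EllPlusOne : Set PSLTilde :=
  {x | ∃ (P : SL(2, ℝ)) (φ : ℝ), 0 < φ ∧ φ < 2 * Real.pi ∧ x = rotLift P φ}

/-- The simplest clockwise lifts of elliptics: rotations through an angle in `(-2π, 0)`. -/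
def EllMinusOne : Set PSLTilde :=
  {x | ∃ (P : SL(2, ℝ)) (φ : ℝ), -(2 * Real.pi) < φ ∧ φ < 0 ∧ x = rotLift P φ}

end

/-! A commutator cannot move every point of a line a full turn in the same direction. The universal
cover of `SL(2, ℝ)` maps onto that of `PSL(2, ℝ)`, and it acts on the line covering the circle of
directions by monotone maps commuting with `x ↦ x + 1` (`lineAct`); the full turn `z` acts as `x ↦ x
+ 1`. If `⁅a, b⁆` moved every point by at least `1`, then `a b a⁻¹` would dominate `b` followed by a
unit translation, whereas conjugate elements have the same translation number. Exchanging `a` and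
`b` gives the opposite bound.

The matrix under `⁅a, b⁆` is, up to sign, conjugate to a dilation, a shift or a rotation. The
Iwasawa decomposition shows that the elements over `±1` are the powers of `z`
(`exists_eq_fullTurn_zpow`), so `⁅a, b⁆ = z ^ n * m` with `m` the class of the model path
(`exists_commutator_eq`). A dilation or shift fixes a point of the line, hence moves every point by
less than `1`, which forces `n ∈ {-1, 0, 1}`. As `z` lies over `-1`, the sign of the trace separates
`n = 0` from `n = ±1`. A shift moves all points weakly in the direction of its sign, which ties this
sign to `n` at trace `-2`. A rotation moves all points equally, so its total angle lies strictly
between `-2π` and `2π`. -/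

noncomputable section

/-! ### The action on directions and its lift to the line -/

/-- The linear action of `SL(2, ℝ)` on the plane, a vector `(p, q)` being the complex number
`p - q I`, so that the orientation of the plane agrees with the one of `ℝ ∪ {∞}`. -/
def planeAct (A : SL(2, ℝ)) (u : ℂ) : ℂ :=
  ⟨A 0 0 * u.re - A 0 1 * u.im, -A 1 0 * u.re + A 1 1 * u.im⟩

theorem planeAct_one (u : ℂ) : planeAct 1 u = u := by
  apply Complex.ext <;> simp [planeAct]

theorem planeAct_mul (A B : SL(2, ℝ)) (u : ℂ) :
    planeAct (A * B) u = planeAct A (planeAct B u) := by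
  apply Complex.ext <;>
    simp [planeAct, Matrix.mul_apply, Fin.sum_univ_two] <;> ring

theorem planeAct_ofReal_mul (A : SL(2, ℝ)) (r : ℝ) (u : ℂ) :
    planeAct A (r * u) = r * planeAct A u := by
  apply Complex.ext <;> simp [planeAct] <;> ring

theorem planeAct_neg (A : SL(2, ℝ)) (u : ℂ) : planeAct A (-u) = -planeAct A u := by
  apply Complex.ext <;> simp [planeAct] <;> ring

theorem planeAct_zero (A : SL(2, ℝ)) : planeAct A 0 = 0 := by
  apply Complex.ext <;> simp [planeAct]

theorem planeAct_inv_planeAct (A : SL(2, ℝ)) (u : ℂ) : planeAct A⁻¹ (planeAct A u) = u := by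
  rw [← planeAct_mul, inv_mul_cancel, planeAct_one]

theorem planeAct_ne_zero (A : SL(2, ℝ)) {u : ℂ} (hu : u ≠ 0) : planeAct A u ≠ 0 := by
  intro h
  apply hu
  rw [← planeAct_inv_planeAct A u, h, planeAct_zero]

theorem continuous_entry (i j : Fin 2) : Continuous fun A : SL(2, ℝ) => A i j :=
  (continuous_apply_apply i j).comp continuous_subtype_val

theorem continuous_planeAct : Continuous fun p : SL(2, ℝ) × ℂ => planeAct p.1 p.2 := by
  have h (i j : Fin 2) : Continuous fun p : SL(2, ℝ) × ℂ => p.1 i j :=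
    (continuous_entry i j).comp continuous_fst
  have e : (fun p : SL(2, ℝ) × ℂ => planeAct p.1 p.2) = fun p =>
      ((p.1 0 0 * p.2.re - p.1 0 1 * p.2.im : ℝ) : ℂ) +
        ((-p.1 1 0 * p.2.re + p.1 1 1 * p.2.im : ℝ) : ℂ) * Complex.I := by
    funext p
    apply Complex.ext <;> simp [planeAct]
  rw [e]
  have h00 := h 0 0
  have h01 := h 0 1
  have h10 := h 1 0
  have h11 := h 1 1
  have hre : Continuous fun p : SL(2, ℝ) × ℂ => p.2.re := Complex.continuous_re.comp continuous_snd
  have him : Continuous fun p : SL(2, ℝ) × ℂ => p.2.im := Complex.continuous_im.comp continuous_snd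
  refine .add (Complex.continuous_ofReal.comp ?_)
    (.mul (Complex.continuous_ofReal.comp ?_) continuous_const)
  · exact (h00.mul hre).sub (h01.mul him)
  · exact (h10.neg.mul hre).add (h11.mul him)

/-! ### The circle of directions and its covering by the line -/

/-- The covering of the circle of directions of the plane by the line, of period `2`. -/
def direction (x : ℝ) : Circle := Circle.exp (Real.pi * x)

theorem isCoveringMap_direction : IsCoveringMap direction := fun u =>
  ((Circle.isCoveringMap_exp u).comp_homeomorph
    (Homeomorph.mulLeft₀ Real.pi Real.pi_ne_zero)).to_isEvenlyCovered_preimage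

theorem continuous_direction : Continuous direction := isCoveringMap_direction.continuous

theorem direction_add_one (x : ℝ) : (direction (x + 1) : ℂ) = -direction x := by
  rw [direction, direction, mul_add, Circle.exp_add]
  simp

theorem direction_re (x : ℝ) : (direction x : ℂ).re = Real.cos (Real.pi * x) := by
  rw [direction, Circle.coe_exp, Complex.exp_ofReal_mul_I_re]

theorem direction_im (x : ℝ) : (direction x : ℂ).im = Real.sin (Real.pi * x) := by
  rw [direction, Circle.coe_exp, Complex.exp_ofReal_mul_I_im]

/-- The action of `SL(2, ℝ)` on the circle of directions. -/
def circleAct (A : SL(2, ℝ)) (u : Circle) : Circle :=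
  ⟨planeAct A u / ‖planeAct A u‖, by
    have h : ‖planeAct A u‖ ≠ 0 := norm_ne_zero_iff.mpr (planeAct_ne_zero A u.coe_ne_zero)
    refine mem_sphere_zero_iff_norm.mpr ?_
    rw [norm_div, Complex.norm_real, norm_norm, div_self h]⟩

theorem continuous_circleAct : Continuous fun p : SL(2, ℝ) × Circle => circleAct p.1 p.2 := by
  refine Continuous.subtype_mk ?_ _
  have h : Continuous fun p : SL(2, ℝ) × Circle => planeAct p.1 p.2 :=
    continuous_planeAct.comp (continuous_fst.prodMk (continuous_subtype_val.comp continuous_snd))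
  refine h.div (Complex.continuous_ofReal.comp h.norm) fun p => ?_
  exact_mod_cast norm_ne_zero_iff.mpr (planeAct_ne_zero p.1 p.2.coe_ne_zero)

/-- Trades the normalised action for linear equations up to a positive factor. -/
theorem circleAct_eq_iff {A : SL(2, ℝ)} {u v : Circle} :
    circleAct A u = v ↔ ∃ r : ℝ, 0 < r ∧ planeAct A u = r * v := by
  have h : 0 < ‖planeAct A u‖ := norm_pos_iff.mpr (planeAct_ne_zero A u.coe_ne_zero)
  have h' : (‖planeAct A u‖ : ℂ) ≠ 0 := by exact_mod_cast h.ne'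
  constructor
  · rintro rfl
    refine ⟨_, h, ?_⟩
    simp only [circleAct]
    field_simp
  · rintro ⟨r, hr, e⟩
    ext
    have hr' : (r : ℂ) ≠ 0 := by exact_mod_cast hr.ne'
    simp only [circleAct, e, norm_mul, Circle.norm_coe, mul_one, Complex.norm_real,
      Real.norm_of_nonneg hr.le]
    field_simp

theorem circleAct_one (u : Circle) : circleAct 1 u = u :=
  circleAct_eq_iff.mpr ⟨1, one_pos, by simp [planeAct_one]⟩

theorem circleAct_mul (A B : SL(2, ℝ)) (u : Circle) :
    circleAct (A * B) u = circleAct A (circleAct B u) := by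
  obtain ⟨r, hr, hB⟩ := circleAct_eq_iff.mp (rfl : circleAct B u = _)
  obtain ⟨s, hs, hA⟩ := circleAct_eq_iff.mp (rfl : circleAct A (circleAct B u) = _)
  refine circleAct_eq_iff.mpr ⟨r * s, by positivity, ?_⟩
  rw [planeAct_mul, hB, planeAct_ofReal_mul, hA]
  push_cast
  ring

theorem circleAct_neg (A : SL(2, ℝ)) (u : Circle) : circleAct A (-u) = -circleAct A u := by
  obtain ⟨r, hr, h⟩ := circleAct_eq_iff.mp (rfl : circleAct A u = _)
  refine circleAct_eq_iff.mpr ⟨r, hr, ?_⟩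
  simp [planeAct_neg, h]

theorem circleAct_injective (A : SL(2, ℝ)) : Function.Injective (circleAct A) := fun u v h => by
  rw [← circleAct_one u, ← circleAct_one v, ← inv_mul_cancel A, circleAct_mul, circleAct_mul, h]

theorem direction_add_one_eq_neg (x : ℝ) : direction (x + 1) = -direction x :=
  Circle.ext (direction_add_one x)

theorem exists_int_of_direction_eq {x y : ℝ} (h : direction x = direction y) :
    ∃ n : ℤ, x = y + n := by
  obtain ⟨m, hm⟩ := Circle.exp_eq_exp.mp h
  refine ⟨2 * m, mul_left_cancel₀ Real.pi_ne_zero ?_⟩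
  rw [hm]
  push_cast
  ring

/-! ### Lifting paths of matrices to isotopies of the line -/

/-- The universal covering group of `SL(2, ℝ)`. -/
abbrev SLTilde : Type := UnivCover SL(2, ℝ)

/-- The lift of the action of a path in `SL(2, ℝ)` on directions to an isotopy of the line. -/
def isotopy (γ : C(I, SL(2, ℝ))) (h : γ 0 = 1) : C(I × ℝ, ℝ) :=
  isCoveringMap_direction.liftHomotopy
    ⟨fun p => circleAct (γ p.1) (direction p.2), continuous_circleAct.comp
      ((γ.continuous.comp continuous_fst).prodMk (continuous_direction.comp continuous_snd))⟩
    (ContinuousMap.id ℝ) (fun x => by simp [h, circleAct_one])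

theorem isotopy_zero (γ : C(I, SL(2, ℝ))) (h : γ 0 = 1) (x : ℝ) : isotopy γ h (0, x) = x :=
  isCoveringMap_direction.liftHomotopy_zero _ _ _ x

theorem direction_isotopy (γ : C(I, SL(2, ℝ))) (h : γ 0 = 1) (t : I) (x : ℝ) :
    direction (isotopy γ h (t, x)) = circleAct (γ t) (direction x) :=
  congr_fun (isCoveringMap_direction.liftHomotopy_lifts _ _ _) (t, x)

/-- Lifts through a covering are unique, so any explicit continuous lift computes the isotopy. -/
theorem eq_isotopy {γ : C(I, SL(2, ℝ))} (h : γ 0 = 1) {f : I → ℝ} (hf : Continuous f) {x : ℝ}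
    (h0 : f 0 = x) (hl : ∀ t, direction (f t) = circleAct (γ t) (direction x)) (t : I) :
    f t = isotopy γ h (t, x) := by
  refine congr_fun (isCoveringMap_direction.eq_of_comp_eq hf
    ((isotopy γ h).continuous.comp (.prodMk_left x)) ?_ 0 ?_) t
  · funext s
    simp only [Function.comp_apply]
    rw [hl, direction_isotopy]
  · simp only [Function.comp_apply]
    rw [h0, isotopy_zero]

theorem isotopy_add_one (γ : C(I, SL(2, ℝ))) (h : γ 0 = 1) (t : I) (x : ℝ) :
    isotopy γ h (t, x + 1) = isotopy γ h (t, x) + 1 := by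
  refine (eq_isotopy h (f := fun t => isotopy γ h (t, x) + 1) ?_ ?_ (fun s => ?_) t).symm
  · exact ((isotopy γ h).continuous.comp (.prodMk_left x)).add continuous_const
  · simp [isotopy_zero]
  · rw [direction_add_one_eq_neg, direction_add_one_eq_neg, circleAct_neg, direction_isotopy]

/-- Two tracks that meet at time `t` lift the same path of directions, hence agree at time `0`. -/
theorem isotopy_injective (γ : C(I, SL(2, ℝ))) (h : γ 0 = 1) (t : I) :
    Function.Injective fun x => isotopy γ h (t, x) := by
  intro x y hxy
  have e : direction x = direction y := by
    apply circleAct_injective (γ t)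
    rw [← direction_isotopy γ h, ← direction_isotopy γ h, show isotopy γ h (t, x) = _ from hxy]
  have hc (x : ℝ) : Continuous fun t => isotopy γ h (t, x) :=
    (isotopy γ h).continuous.comp (.prodMk_left x)
  have := isCoveringMap_direction.eq_of_comp_eq (hc x) (hc y)
    (by funext s; simp [direction_isotopy, e]) t hxy
  simpa [isotopy_zero] using congr_fun this 0

/-- A continuous injection of the line is strictly monotone, and commuting with `x ↦ x + 1` rules
out decreasing. -/
theorem isotopy_monotone (γ : C(I, SL(2, ℝ))) (h : γ 0 = 1) (t : I) :
    Monotone fun x => isotopy γ h (t, x) := by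
  have hc : Continuous fun x => isotopy γ h (t, x) :=
    (isotopy γ h).continuous.comp (.prodMk_right t)
  rcases hc.strictMono_of_inj (isotopy_injective γ h t) with hm | hm
  · exact hm.monotone
  · have := hm (lt_add_one 0)
    simp only [isotopy_add_one] at this
    linarith

theorem isotopy_mul (γ δ : C(I, SL(2, ℝ))) (hγ : γ 0 = 1) (hδ : δ 0 = 1) (t : I) (x : ℝ) :
    isotopy (γ * δ) (by simp [hγ, hδ]) (t, x) = isotopy γ hγ (t, isotopy δ hδ (t, x)) := by
  refine (eq_isotopy _ (f := fun t => isotopy γ hγ (t, isotopy δ hδ (t, x))) ?_ ?_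
    (fun s => ?_) t).symm
  · exact (isotopy γ hγ).continuous.comp
      (continuous_id.prodMk ((isotopy δ hδ).continuous.comp (.prodMk_left x)))
  · simp [isotopy_zero]
  · rw [direction_isotopy, direction_isotopy, ContinuousMap.mul_apply, circleAct_mul]

theorem isotopy_one_eq_of_homotopicRel {γ δ : C(I, SL(2, ℝ))} (hγ : γ 0 = 1) (hδ : δ 0 = 1)
    (H : γ.HomotopicRel δ {0, 1}) (x : ℝ) : isotopy γ hγ (1, x) = isotopy δ hδ (1, x) := by
  let F : C(SL(2, ℝ), Circle) :=
    ⟨fun A => circleAct A (direction x), continuous_circleAct.comp (.prodMk_left _)⟩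
  have h0 : F 1 = direction x := circleAct_one _
  have h1 := isCoveringMap_direction.liftPath_apply_one_eq_of_homotopicRel
    (H.comp_continuousMap F) x (by simp [hγ, h0]) (by simp [hδ, h0])
  have h2 {ε : C(I, SL(2, ℝ))} (hε : ε 0 = 1) :=
    eq_isotopy hε (isCoveringMap_direction.liftPath (F.comp ε) x (by simp [hε, h0])).continuous
      (isCoveringMap_direction.liftPath_zero _ _ _)
      (fun t => congr_fun (isCoveringMap_direction.liftPath_lifts _ _ _) t) 1
  rw [← h2 hγ, ← h2 hδ, h1]

/-- The action of the universal cover of `SL(2, ℝ)` on the universal cover of the projective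
line. -/
def lineAct : SLTilde →* CircleDeg1Lift :=
  (homotopyCon SL(2, ℝ)).lift
    { toFun := fun γ =>
        ⟨⟨fun x => isotopy γ.1 γ.2 (1, x), isotopy_monotone _ _ 1⟩, isotopy_add_one _ _ 1⟩
      map_one' := by
        ext x
        exact (eq_isotopy (γ := 1) rfl (f := fun _ => x) continuous_const rfl
          (fun t => (circleAct_one _).symm) 1).symm
      map_mul' := fun γ δ => by
        ext x
        exact isotopy_mul γ.1 δ.1 γ.2 δ.2 1 x }
    (fun γ δ h => by
      ext x
      exact isotopy_one_eq_of_homotopicRel γ.2 δ.2 h x)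

theorem lineAct_mk {γ : C(I, SL(2, ℝ))} (h : γ 0 = 1) {f : I → ℝ} (hf : Continuous f) {x : ℝ}
    (h0 : f 0 = x) (hl : ∀ t, ∃ r : ℝ, 0 < r ∧ planeAct (γ t) (direction x) = r * direction (f t)) :
    lineAct (UnivCover.mk γ h) x = f 1 :=
  (eq_isotopy h hf h0 (fun t => (circleAct_eq_iff.mpr (hl t)).symm) 1).symm

theorem direction_lineAct (a : SLTilde) (x : ℝ) :
    direction (lineAct a x) = circleAct (UnivCover.proj a) (direction x) := by
  induction a using Quotient.inductionOn with
  | h γ => exact direction_isotopy γ.1 γ.2 1 x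

/-! ### Displacement bounds for commutators -/

/-- A commutator moves some point of the line by less than one turn. -/
theorem exists_lineAct_commutator_lt (a b : SLTilde) : ∃ x, lineAct ⁅a, b⁆ x < x + 1 := by
  by_contra! h
  let u : SLTilde →* CircleDeg1Liftˣ := lineAct.toHomUnits
  -- Since `⁅a, b⁆ b = a b a⁻¹`, the assumption at the point `b x` compares `a b a⁻¹` with `b`.
  have h1 : (CircleDeg1Lift.translate (Multiplicative.ofAdd 1) : CircleDeg1Lift) * lineAct b ≤
      lineAct (a * b * a⁻¹) := fun x => by
    have := h (lineAct b x)
    rw [← CircleDeg1Lift.mul_apply, ← map_mul, commutatorElement_def, inv_mul_cancel_right] at this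
    rw [CircleDeg1Lift.mul_apply, CircleDeg1Lift.translate_apply]
    linarith
  have h2 := CircleDeg1Lift.translationNumber_mono h1
  have h3 : CircleDeg1Lift.translationNumber (lineAct (a * b * a⁻¹)) =
      CircleDeg1Lift.translationNumber (lineAct b) := by
    rw [← CircleDeg1Lift.translationNumber_conj_eq (u a) (lineAct b)]
    congr 1
    rw [map_mul, map_mul, ← map_inv u a]
    rfl
  rw [h3, CircleDeg1Lift.translationNumber_mul_of_commute,
    CircleDeg1Lift.translationNumber_translate] at h2
  · linarith
  · rw [CircleDeg1Lift.commute_iff_commute]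
    intro x
    simp [add_comm]

/-- The inverse `⁅b, a⁆` moves some point by less than `1`; its image is the required point. -/
theorem exists_lt_lineAct_commutator (a b : SLTilde) : ∃ x, x - 1 < lineAct ⁅a, b⁆ x := by
  obtain ⟨x, hx⟩ := exists_lineAct_commutator_lt b a
  refine ⟨lineAct ⁅b, a⁆ x, ?_⟩
  rw [← commutatorElement_inv a b] at hx ⊢
  rw [← CircleDeg1Lift.mul_apply, ← map_mul, mul_inv_cancel, map_one,
    CircleDeg1Lift.coe_one, id]
  linarith

/-! ### Homotopies in the universal covering group -/

section Homotopy

variable {G : Type*} [Group G] [TopologicalSpace G] [IsTopologicalGroup G]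

theorem UnivCover.mk_eq_mk_of_homotopy {γ δ : C(I, G)} (hγ : γ 0 = 1) (hδ : δ 0 = 1)
    (H : I × I → G) (hH : Continuous H) (h0 : ∀ t, H (0, t) = γ t) (h1 : ∀ t, H (1, t) = δ t)
    (hl : ∀ s, H (s, 0) = 1) (hr : ∀ s, H (s, 1) = γ 1) :
    UnivCover.mk γ hγ = UnivCover.mk δ hδ := by
  refine Quotient.sound ⟨⟨⟨⟨H, hH⟩, h0, h1⟩, fun s t ht => ?_⟩⟩
  rcases ht with rfl | rfl
  · exact (hl s).trans hγ.symm
  · exact hr s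

theorem UnivCover.exists_mk (x : UnivCover G) :
    ∃ (γ : C(I, G)) (h : γ 0 = 1), x = UnivCover.mk γ h := by
  induction x using Quotient.inductionOn with
  | h γ => exact ⟨γ.1, γ.2, rfl⟩

theorem UnivCover.proj_mk {γ : C(I, G)} (h : γ 0 = 1) :
    UnivCover.proj (UnivCover.mk γ h) = γ 1 := rfl

/-- Conjugating `γ t` by `p (max s t)` deforms the conjugator from `p t` to the constant `p 1`; the
ends stay fixed because `γ 0 = 1` and `max s 1 = 1`. -/
theorem UnivCover.conj_mk (x : UnivCover G) {γ δ : C(I, G)} (hγ : γ 0 = 1) (hδ : δ 0 = 1)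
    (h : ∀ t, δ t = UnivCover.proj x * γ t * (UnivCover.proj x)⁻¹) :
    x * UnivCover.mk γ hγ * x⁻¹ = UnivCover.mk δ hδ := by
  obtain ⟨p, hp, rfl⟩ := UnivCover.exists_mk x
  change UnivCover.mk (p * γ * p⁻¹) (by simp [hp, hγ]) = _
  refine UnivCover.mk_eq_mk_of_homotopy _ _
    (fun q => p (q.1 ⊔ q.2) * γ q.2 * (p (q.1 ⊔ q.2))⁻¹) (by fun_prop) (fun t => ?_) (fun t => ?_)
    (fun s => ?_) (fun s => ?_)
  · simp
  · rw [h, UnivCover.proj_mk, max_eq_left (show t ≤ 1 from t.2.2)]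
  · simp [hγ]
  · rw [max_eq_right (show s ≤ 1 from s.2.2)]
    rfl

/-- Conjugating by `p (min s t)` deforms `γ` into `p γ p⁻¹`; the final endpoint stays fixed because
`γ 1` is central. -/
theorem UnivCover.commute_mk (x : UnivCover G) {γ : C(I, G)} (hγ : γ 0 = 1)
    (h : ∀ g, Commute g (γ 1)) : Commute x (UnivCover.mk γ hγ) := by
  obtain ⟨p, hp, rfl⟩ := UnivCover.exists_mk x
  have e (g : G) : g * γ 1 * g⁻¹ = γ 1 := by rw [(h g).eq, mul_inv_cancel_right]
  refine mul_inv_eq_iff_eq_mul.mp ?_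
  change UnivCover.mk (p * γ * p⁻¹) (by simp [hp, hγ]) = _
  refine (UnivCover.mk_eq_mk_of_homotopy (γ := γ) _ _
    (fun q => p (q.1 ⊓ q.2) * γ q.2 * (p (q.1 ⊓ q.2))⁻¹) (by fun_prop) (fun t => ?_) (fun t => ?_)
    (fun s => ?_) (fun s => ?_)).symm
  · simp [hp]
  · rw [min_eq_right (show t ≤ 1 from t.2.2)]
    rfl
  · simp [hγ, hp]
  · exact e _

/-- The class of the path `t ↦ P g(t x) P⁻¹`, for a path `g` of group elements with `g 0 = 1`. -/
def flowLift (g : C(ℝ, G)) (hg : g 0 = 1) (P : G) (x : ℝ) : UnivCover G :=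
  UnivCover.mk ⟨fun t : I => P * g (t * x) * P⁻¹, by fun_prop⟩ (by simp [hg])

theorem proj_flowLift (g : C(ℝ, G)) (hg : g 0 = 1) (P : G) (x : ℝ) :
    UnivCover.proj (flowLift g hg P x) = P * g x * P⁻¹ := by
  simp [flowLift, UnivCover.proj_mk]

theorem conj_flowLift (g : C(ℝ, G)) (hg : g 0 = 1) (p : UnivCover G) (x : ℝ) :
    p * flowLift g hg 1 x * p⁻¹ = flowLift g hg (UnivCover.proj p) x :=
  UnivCover.conj_mk p _ _ fun t => by simp

theorem flowLift_zero (g : C(ℝ, G)) (hg : g 0 = 1) (P : G) : flowLift g hg P 0 = 1 := by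
  have h : (⟨fun t : I => P * g (t * 0) * P⁻¹, by fun_prop⟩ : C(I, G)) = 1 := by
    ext t
    simp [hg]
  simp only [flowLift, h]
  rfl

/-- The map of universal covers induced by a continuous homomorphism. -/
def UnivCover.map {K : Type*} [Group K] [TopologicalSpace K] [IsTopologicalGroup K] (f : G →* K)
    (hf : Continuous f) : UnivCover G →* UnivCover K :=
  (homotopyCon G).lift
    ((homotopyCon K).mk'.comp
      { toFun := fun γ => ⟨(⟨f, hf⟩ : C(G, K)).comp γ.1, by
          change f (γ.1 0) = 1
          rw [show γ.1 0 = 1 from γ.2, map_one]⟩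
        map_one' := by ext; simp
        map_mul' := fun _ _ => by ext; simp })
    (fun _ _ h => Quotient.sound (ContinuousMap.HomotopicRel.comp_continuousMap h ⟨f, hf⟩))

end Homotopy

/-! ### Passage from `PSL(2, ℝ)` to `SL(2, ℝ)` -/

/-- The identification of the universal covers of `SL(2, ℝ)` and `PSL(2, ℝ)`. -/
def coverMap : SLTilde →* PSLTilde := UnivCover.map toPSL continuous_toPSL

theorem coverMap_surjective : Function.Surjective coverMap := by
  intro x
  obtain ⟨γ, h, rfl⟩ := UnivCover.exists_mk x
  have h' : γ 0 = toPSL 1 := by rw [h, map_one]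
  refine ⟨UnivCover.mk (isCoveringMap_toPSL.liftPath γ 1 h')
    (isCoveringMap_toPSL.liftPath_zero _ _ _), ?_⟩
  change UnivCover.mk _ _ = _
  congr 1
  ext1 t
  exact congr_fun (isCoveringMap_toPSL.liftPath_lifts γ 1 h') t

/-- By uniqueness of path lifting, the trace on the cover becomes the trace of the projected matrix.
-/
theorem toSL_coverMap (y : SLTilde) : toSL (coverMap y) = UnivCover.proj y := by
  obtain ⟨γ, h, rfl⟩ := UnivCover.exists_mk y
  have := (isCoveringMap_toPSL.eq_liftPath_iff' (γ := (⟨toPSL, continuous_toPSL⟩ : C(_, _)).comp γ)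
    (e := 1) (by simp [h])).mpr ⟨rfl, h⟩
  exact (DFunLike.congr_fun this 1).symm

/-- The flow of dilations in `SL(2, ℝ)`. -/
def dilationFlow : C(ℝ, SL(2, ℝ)) := ⟨dilationSL, continuous_dilationSL⟩

/-- The flow of shifts in `SL(2, ℝ)`. -/
def shiftFlow : C(ℝ, SL(2, ℝ)) := ⟨shiftSL, continuous_shiftSL⟩

/-- The flow of rotations in `SL(2, ℝ)`. -/
def rotationFlow : C(ℝ, SL(2, ℝ)) := ⟨rotationSL, continuous_rotationSL⟩

theorem dilationFlow_zero : dilationFlow 0 = 1 := dilationSL_zero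

theorem shiftFlow_zero : shiftFlow 0 = 1 := shiftSL_zero

theorem rotationFlow_zero : rotationFlow 0 = 1 := rotationSL_zero

theorem coverMap_flowLift_dilation (P : SL(2, ℝ)) (d : ℝ) :
    coverMap (flowLift dilationFlow dilationFlow_zero P d) = hypLift P d := rfl

theorem coverMap_flowLift_shift (P : SL(2, ℝ)) (s : ℝ) :
    coverMap (flowLift shiftFlow shiftFlow_zero P s) = parLift P s := rfl

theorem coverMap_flowLift_rotation (P : SL(2, ℝ)) (φ : ℝ) :
    coverMap (flowLift rotationFlow rotationFlow_zero P φ) = rotLift P φ := rfl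

/-- The full anticlockwise turn in the universal cover of `SL(2, ℝ)`. -/
def fullTurn : SLTilde := flowLift rotationFlow rotationFlow_zero 1 (2 * Real.pi)

theorem coverMap_fullTurn : coverMap fullTurn = zTilde := rfl

theorem coe_dilationSL (d : ℝ) :
    (dilationSL d).1 = !![Real.exp (d / 2), 0; 0, Real.exp (-(d / 2))] := rfl

theorem coe_shiftSL (s : ℝ) : (shiftSL s).1 = !![1, s; 0, 1] := rfl

theorem coe_rotationSL (φ : ℝ) : (rotationSL φ).1 =
    !![Real.cos (φ / 2), Real.sin (φ / 2); -Real.sin (φ / 2), Real.cos (φ / 2)] := rfl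

theorem rotationSL_add (φ ψ : ℝ) : rotationSL (φ + ψ) = rotationSL φ * rotationSL ψ := by
  ext i j
  fin_cases i <;> fin_cases j <;>
    simp [coe_rotationSL, Matrix.SpecialLinearGroup.coe_mul, add_div, Real.cos_add, Real.sin_add] <;>
    ring

/-- The one-parameter group of rotations about `I` in the universal cover. -/
def rotationHom : Multiplicative ℝ →* SLTilde where
  toFun φ := flowLift rotationFlow rotationFlow_zero 1 φ.toAdd
  map_one' := flowLift_zero _ _ _
  map_mul' φ ψ := by
    change UnivCover.mk _ _ = UnivCover.mk (_ * _) _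
    congr 1
    ext1 t
    simp [rotationFlow, mul_add, rotationSL_add]

theorem fullTurn_zpow (n : ℤ) :
    fullTurn ^ n = flowLift rotationFlow rotationFlow_zero 1 (n * (2 * Real.pi)) := by
  change rotationHom (Multiplicative.ofAdd (2 * Real.pi)) ^ n = rotationHom (Multiplicative.ofAdd _)
  rw [← map_zpow, ← ofAdd_zsmul, zsmul_eq_mul]
  rfl

theorem fullTurn_zpow_mul_rotation (n : ℤ) (φ : ℝ) :
    fullTurn ^ n * flowLift rotationFlow rotationFlow_zero 1 φ =
      flowLift rotationFlow rotationFlow_zero 1 (n * (2 * Real.pi) + φ) := by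
  rw [fullTurn_zpow]
  exact (map_mul rotationHom (Multiplicative.ofAdd _) (Multiplicative.ofAdd _)).symm

theorem rotationSL_two_pi : rotationSL (2 * Real.pi) = -1 := by
  ext i j
  fin_cases i <;> fin_cases j <;> simp [rotationSL]

theorem proj_fullTurn : UnivCover.proj fullTurn = -1 := by
  rw [fullTurn, proj_flowLift]
  simp [rotationFlow, rotationSL_two_pi]

theorem commute_fullTurn (x : SLTilde) : Commute x fullTurn :=
  UnivCover.commute_mk x _ fun g => by
    simp [rotationFlow, rotationSL_two_pi, Commute, SemiconjBy]

/-! ### The Iwasawa decomposition and the kernel of the covering -/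

/-- A hyperbolic rotation by `φ` turns vectors by `φ / 2`, and a half turn of vectors is one unit of
the line. -/
theorem planeAct_rotationSL (φ x : ℝ) :
    planeAct (rotationSL φ) (direction x) = direction (x + φ / (2 * Real.pi)) := by
  have h : Real.pi * (x + φ / (2 * Real.pi)) = Real.pi * x + φ / 2 := by
    have := Real.pi_ne_zero
    field_simp
  apply Complex.ext
  · rw [direction_re, h, Real.cos_add]
    simp [planeAct, rotationSL, direction_re, direction_im]
    ring
  · rw [direction_im, h, Real.sin_add]
    simp [planeAct, rotationSL, direction_re, direction_im]
    ring

theorem circleAct_rotationSL (φ x : ℝ) :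
    circleAct (rotationSL φ) (direction x) = direction (x + φ / (2 * Real.pi)) :=
  circleAct_eq_iff.mpr ⟨1, one_pos, by simp [planeAct_rotationSL]⟩

theorem direction_zero : direction 0 = 1 := by simp [direction]

theorem entries_of_circleAct_one {B : SL(2, ℝ)} (h : circleAct B 1 = 1) :
    0 < B 0 0 ∧ B 1 0 = 0 := by
  obtain ⟨r, hr, e⟩ := circleAct_eq_iff.mp h
  have h1 := congrArg Complex.re e
  have h2 := congrArg Complex.im e
  simp [planeAct] at h1 h2
  exact ⟨h1 ▸ hr, h2⟩

theorem entries_dilationSL_mul_shiftSL (d s : ℝ) :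
    (dilationSL d * shiftSL s : SL(2, ℝ)).1 =
      !![Real.exp (d / 2), Real.exp (d / 2) * s; 0, Real.exp (-(d / 2))] := by
  simp [coe_dilationSL, coe_shiftSL, Matrix.SpecialLinearGroup.coe_mul]

theorem eq_dilationSL_mul_shiftSL {B : SL(2, ℝ)} (h0 : 0 < B 0 0) (h1 : B 1 0 = 0) :
    B = dilationSL (2 * Real.log (B 0 0)) * shiftSL (B 0 1 / B 0 0) := by
  have hdet := B.2
  rw [Matrix.det_fin_two] at hdet
  have h11 : B 1 1 = (B 0 0)⁻¹ := by
    rw [h1, mul_zero, sub_zero] at hdet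
    exact eq_inv_of_mul_eq_one_right hdet
  apply Subtype.ext
  rw [entries_dilationSL_mul_shiftSL, mul_div_cancel_left₀ _ two_ne_zero, Real.exp_neg,
    Real.exp_log h0, mul_div_cancel₀ _ h0.ne']
  ext i j
  fin_cases i <;> fin_cases j <;> simp [h1, h11]

/-- Undoing the rotation of the first axis leaves a matrix fixing the positive real direction: the
triangular Iwasawa factor. -/
theorem triangular_of_direction_eq {A : SL(2, ℝ)} {x : ℝ} (h : direction x = circleAct A 1) :
    0 < (rotationSL (-(2 * Real.pi * x)) * A) 0 0 ∧
      (rotationSL (-(2 * Real.pi * x)) * A) 1 0 = 0 := by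
  apply entries_of_circleAct_one
  have := Real.pi_ne_zero
  rw [circleAct_mul, ← h, circleAct_rotationSL, ← direction_zero]
  congr 1
  field_simp
  ring

theorem eq_rotationSL_mul (φ : ℝ) (A : SL(2, ℝ)) :
    A = rotationSL φ * (rotationSL (-φ) * A) := by
  rw [← mul_assoc, ← rotationSL_add, add_neg_cancel, rotationSL_zero, one_mul]

theorem direction_surjective : Function.Surjective direction := fun u =>
  ⟨Complex.arg u / Real.pi, by
    rw [direction, mul_div_cancel₀ _ Real.pi_ne_zero, Circle.exp_arg]⟩

theorem proj_surjective : Function.Surjective (UnivCover.proj : SLTilde →* SL(2, ℝ)) := by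
  intro A
  obtain ⟨x, hx⟩ := direction_surjective (circleAct A 1)
  obtain ⟨h0, h1⟩ := triangular_of_direction_eq hx
  rw [eq_rotationSL_mul (2 * Real.pi * x) A, eq_dilationSL_mul_shiftSL h0 h1]
  generalize 2 * Real.log ((rotationSL (-(2 * Real.pi * x)) * A) 0 0) = d
  generalize (rotationSL (-(2 * Real.pi * x)) * A) 0 1 / _ = s
  refine ⟨flowLift rotationFlow rotationFlow_zero 1 (2 * Real.pi * x) *
    (flowLift dilationFlow dilationFlow_zero 1 d * flowLift shiftFlow shiftFlow_zero 1 s), ?_⟩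
  simp [proj_flowLift, dilationFlow, rotationFlow, shiftFlow]

/-- Uniqueness in the Iwasawa decomposition: the positive diagonal entry settles the sign. -/
theorem eq_one_of_triangular_rotation {B : SL(2, ℝ)} {φ : ℝ} (h0 : 0 < B 0 0) (h1 : B 1 0 = 0)
    (h : B = rotationSL φ ∨ B = -rotationSL φ) : B = 1 := by
  have h2 : B 0 1 = 0 := by
    have : B 0 1 = -B 1 0 := by rcases h with rfl | rfl <;> simp [coe_rotationSL]
    rw [this, h1, neg_zero]
  have h3 : B 0 0 = B 1 1 := by rcases h with rfl | rfl <;> simp [coe_rotationSL]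
  have hdet := B.2
  rw [Matrix.det_fin_two, ← h3, h2, zero_mul, sub_zero] at hdet
  have h4 : B 0 0 = 1 := by nlinarith
  ext i j
  fin_cases i <;> fin_cases j
  · exact h4
  · exact h2
  · exact h1
  · exact h3 ▸ h4

/-- The elements of the universal cover over `± 1` are the powers of the full turn. -/
theorem exists_eq_fullTurn_zpow {x : SLTilde}
    (h : UnivCover.proj x = 1 ∨ UnivCover.proj x = -1) : ∃ n : ℤ, x = fullTurn ^ n := by
  obtain ⟨γ, hγ, rfl⟩ := UnivCover.exists_mk x
  rw [UnivCover.proj_mk] at h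
  let f : I → ℝ := fun t => isotopy γ hγ (t, 0)
  have hf : Continuous f := (isotopy γ hγ).continuous.comp (.prodMk_left 0)
  let B : I → SL(2, ℝ) := fun t => rotationSL (-(2 * Real.pi * f t)) * γ t
  have hBc : Continuous B := (continuous_rotationSL.comp (by fun_prop)).mul γ.continuous
  have hfd (t : I) : direction (f t) = circleAct (γ t) 1 := by
    rw [← direction_zero]
    exact direction_isotopy γ hγ t 0
  have hB (t : I) : 0 < B t 0 0 ∧ B t 1 0 = 0 := triangular_of_direction_eq (hfd t)
  have hγB (t : I) : γ t = rotationSL (2 * Real.pi * f t) * B t := eq_rotationSL_mul _ _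
  have hf0 : f 0 = 0 := isotopy_zero γ hγ 0
  have hB0 : B 0 = 1 := by simp [B, hf0, rotationSL_zero, hγ]
  have hB1 : B 1 = 1 := eq_one_of_triangular_rotation (φ := -(2 * Real.pi * f 1)) (hB 1).1 (hB 1).2
    (h.imp (fun h => by simp only [B, h, mul_one]) (fun h => by simp only [B, h, mul_neg, mul_one]))
  -- The endpoint `±1` sends the direction of `0` to itself or its opposite, so the lifted angle
  -- ends at an integer.
  obtain ⟨n, hn⟩ : ∃ n : ℤ, f 1 = n := by
    rcases h with h | h
    · have := hfd 1
      rw [h, circleAct_one, ← direction_zero] at this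
      simpa using exists_int_of_direction_eq this
    · have e : circleAct (-1) 1 = direction (0 + 1) := by
        refine circleAct_eq_iff.mpr ⟨1, one_pos, ?_⟩
        rw [direction_add_one, direction_zero]
        apply Complex.ext <;> simp [planeAct]
      have := hfd 1
      rw [h, e] at this
      obtain ⟨n, hn⟩ := exists_int_of_direction_eq this
      exact ⟨n + 1, by rw [hn]; push_cast; ring⟩
  refine ⟨n, ?_⟩
  rw [fullTurn_zpow]
  let d : I → ℝ := fun t => 2 * Real.log (B t 0 0)
  let s : I → ℝ := fun t => B t 0 1 / B t 0 0
  have hdc : Continuous d := continuous_const.mul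
    (((continuous_entry 0 0).comp hBc).log fun t => (hB t).1.ne')
  have hsc : Continuous s :=
    ((continuous_entry 0 1).comp hBc).div ((continuous_entry 0 0).comp hBc) fun t => (hB t).1.ne'
  have hBds (t : I) : B t = dilationSL (d t) * shiftSL (s t) :=
    eq_dilationSL_mul_shiftSL (hB t).1 (hB t).2
  have hds {t : I} (h : B t = 1) : d t = 0 ∧ s t = 0 := by simp [d, s, h]
  -- Straight-line homotopy in Iwasawa coordinates: the angle is interpolated to a uniform rotation
  -- while the dilation and shift parameters shrink to `0`.
  refine UnivCover.mk_eq_mk_of_homotopy _ _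
    (fun p => rotationSL ((1 - p.1) * (2 * Real.pi * f p.2) + p.1 * (p.2 * (n * (2 * Real.pi)))) *
      (dilationSL ((1 - p.1) * d p.2) * shiftSL ((1 - p.1) * s p.2))) ?_ (fun t => ?_) (fun t => ?_)
      (fun t => ?_) (fun t => ?_)
  · exact (continuous_rotationSL.comp (by fun_prop)).mul
      ((continuous_dilationSL.comp (by fun_prop)).mul (continuous_shiftSL.comp (by fun_prop)))
  · simp [hγB t, hBds t]
  · simp [dilationSL_zero, shiftSL_zero, rotationFlow]
  · simp [hds hB0, hf0, dilationSL_zero, shiftSL_zero, rotationSL_zero]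
  · rw [hγB 1, hB1, (hds hB1).1, (hds hB1).2, hn]
    simp only [mul_zero, dilationSL_zero, shiftSL_zero, mul_one]
    congr 1
    simp
    ring

/-! ### Conjugacy classes of `SL(2, ℝ)` -/

theorem det_eq_one (A : SL(2, ℝ)) : A 0 0 * A 1 1 - A 0 1 * A 1 0 = 1 := by
  rw [← Matrix.det_fin_two]
  exact A.2

theorem trace_eq (A : SL(2, ℝ)) : (A : Matrix (Fin 2) (Fin 2) ℝ).trace = A 0 0 + A 1 1 :=
  Matrix.trace_fin_two _

theorem trace_conj (P A : SL(2, ℝ)) :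
    (P * A * P⁻¹ : SL(2, ℝ)).1.trace = A.1.trace := by
  change (P.1 * A.1 * (P⁻¹).1).trace = _
  rw [Matrix.trace_mul_comm, ← mul_assoc]
  have : (P⁻¹).1 * P.1 = 1 := congrArg Subtype.val (inv_mul_cancel P)
  rw [this, one_mul]

/-- The matrix of determinant one with a given first column. -/
def ofColumn (p q : ℝ) (h : p ^ 2 + q ^ 2 ≠ 0) : SL(2, ℝ) :=
  ⟨!![p, -q / (p ^ 2 + q ^ 2); q, p / (p ^ 2 + q ^ 2)], by
    rw [Matrix.det_fin_two_of]
    field_simp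
    ring⟩

theorem coe_ofColumn {p q : ℝ} (h : p ^ 2 + q ^ 2 ≠ 0) :
    (ofColumn p q h).1 = !![p, -q / (p ^ 2 + q ^ 2); q, p / (p ^ 2 + q ^ 2)] := rfl

theorem coe_inv_ofColumn {p q : ℝ} (h : p ^ 2 + q ^ 2 ≠ 0) :
    ((ofColumn p q h)⁻¹).1 = !![p / (p ^ 2 + q ^ 2), q / (p ^ 2 + q ^ 2); -q, p] := by
  rw [Matrix.SpecialLinearGroup.coe_inv, coe_ofColumn, Matrix.adjugate_fin_two_of, neg_div, neg_neg]

/-- A matrix with a real eigenvalue is conjugate to an upper triangular one. -/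
theorem exists_conj_triangular {A : SL(2, ℝ)} {l : ℝ}
    (hl : l ^ 2 - (A 0 0 + A 1 1) * l + 1 = 0) :
    ∃ (P : SL(2, ℝ)) (m : ℝ), (P⁻¹ * A * P : SL(2, ℝ)).1 = !![l, m; 0, l⁻¹] := by
  have hdet := det_eq_one A
  obtain ⟨p, q, h, h0, h1⟩ : ∃ p q : ℝ, p ^ 2 + q ^ 2 ≠ 0 ∧ A 0 0 * p + A 0 1 * q = l * p ∧
      A 1 0 * p + A 1 1 * q = l * q := by
    -- Each row of `A - l` suggests an eigenvector, `(A 0 1, l - A 0 0)` or `(l - A 1 1, A 1 0)`; if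
    -- both vanish, `A` is scalar and `(1, 0)` serves.
    by_cases hb : A 0 1 ^ 2 + (l - A 0 0) ^ 2 = 0
    · have hb1 : A 0 1 = 0 := by nlinarith [sq_nonneg (A 0 1), sq_nonneg (l - A 0 0)]
      have hb2 : l - A 0 0 = 0 := by nlinarith [sq_nonneg (A 0 1), sq_nonneg (l - A 0 0)]
      by_cases hc : (l - A 1 1) ^ 2 + A 1 0 ^ 2 = 0
      · have hc1 : A 1 0 = 0 := by nlinarith [sq_nonneg (A 1 0), sq_nonneg (l - A 1 1)]
        exact ⟨1, 0, by norm_num, by linarith, by rw [hc1]; ring⟩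
      · exact ⟨_, _, hc, by linear_combination hb1 * A 1 0 - (l - A 1 1) * hb2, by ring⟩
    · exact ⟨_, _, hb, by ring, by linear_combination (-1 : ℝ) * hl - hdet⟩
  have hP : A.1 * (ofColumn p q h).1 =
      !![l * p, A 0 0 * (-q / (p ^ 2 + q ^ 2)) + A 0 1 * (p / (p ^ 2 + q ^ 2));
        l * q, A 1 0 * (-q / (p ^ 2 + q ^ 2)) + A 1 1 * (p / (p ^ 2 + q ^ 2))] := by
    ext i j
    fin_cases i <;> fin_cases j <;> simp [coe_ofColumn, h0, h1, Matrix.mul_apply]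
  set M : SL(2, ℝ) := (ofColumn p q h)⁻¹ * A * ofColumn p q h with hM
  have hMv : M.1 = ((ofColumn p q h)⁻¹).1 * (A.1 * (ofColumn p q h).1) := by
    rw [← mul_assoc]
    rfl
  rw [hP] at hMv
  have h00 : M 0 0 = l := by
    rw [hMv, coe_inv_ofColumn]
    simp
    field_simp
  have h10 : M 1 0 = 0 := by
    rw [hMv, coe_inv_ofColumn]
    simp
    ring
  have h11 : M 1 1 = l⁻¹ := by
    have := det_eq_one M
    rw [h00, h10, mul_zero, sub_zero] at this
    exact eq_inv_of_mul_eq_one_right this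
  refine ⟨ofColumn p q h, M 0 1, ?_⟩
  rw [← hM]
  ext i j
  fin_cases i <;> fin_cases j <;> simp [h00, h10, h11]

theorem eq_conj_of_conj_eq {P A M : SL(2, ℝ)} (h : P⁻¹ * A * P = M) : A = P * M * P⁻¹ := by
  rw [← h]
  group

theorem exists_conj_shiftSL {A : SL(2, ℝ)} (h : A.1.trace = 2) :
    ∃ P s, A = P * shiftSL s * P⁻¹ := by
  rw [trace_eq] at h
  obtain ⟨P, m, hm⟩ := exists_conj_triangular (A := A) (l := 1) (by rw [h]; norm_num)
  exact ⟨P, m, eq_conj_of_conj_eq (Subtype.ext (by rw [hm, inv_one]; rfl))⟩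

theorem exists_conj_dilationSL {A : SL(2, ℝ)} (h : 2 < A.1.trace) :
    ∃ P d, 0 < d ∧ A = P * dilationSL d * P⁻¹ := by
  rw [trace_eq] at h
  set T := A 0 0 + A 1 1 with hT
  have hs : 0 < T ^ 2 - 4 := by nlinarith
  have hr := Real.sqrt_pos.mpr hs
  have hq := Real.sq_sqrt hs.le
  set r := √(T ^ 2 - 4)
  set l := (T + r) / 2 with hl
  have hl1 : 1 < l := by linarith
  have hl0 : 0 < l := by linarith
  obtain ⟨P, m, hm⟩ := exists_conj_triangular (A := A) (l := l) (by
    rw [← hT, hl]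
    linear_combination hq / 4)
  have hd : l - l⁻¹ ≠ 0 := by
    have := inv_lt_one_of_one_lt₀ hl1
    linarith
  -- The eigenvalues `l` and `l⁻¹` differ, so conjugation by a shift removes the off-diagonal entry
  -- `m`.
  obtain ⟨k, hk⟩ : ∃ k, l * k - k * l⁻¹ = m := ⟨m / (l - l⁻¹), by
    rw [mul_comm l, ← mul_sub, div_mul_cancel₀ _ hd]⟩
  have h2 : shiftSL (-k) * dilationSL (2 * Real.log l) * shiftSL k = P⁻¹ * A * P := by
    apply Subtype.ext
    rw [hm, Matrix.SpecialLinearGroup.coe_mul, Matrix.SpecialLinearGroup.coe_mul, coe_dilationSL,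
      coe_shiftSL, coe_shiftSL, mul_div_cancel_left₀ _ (two_ne_zero' ℝ), Real.exp_neg,
      Real.exp_log hl0, ← hk]
    simp [sub_eq_add_neg]
  have h3 : shiftSL (-k) = (shiftSL k)⁻¹ := by
    rw [eq_inv_iff_mul_eq_one]
    apply Subtype.ext
    simp [coe_shiftSL, Matrix.SpecialLinearGroup.coe_mul, Matrix.one_fin_two]
  refine ⟨P * (shiftSL k)⁻¹, 2 * Real.log l, by
    have := Real.log_pos hl1
    linarith, ?_⟩
  rw [eq_conj_of_conj_eq h2.symm, h3]
  group

/-- The trace fixes `φ` only up to sign. With `c` the lower-left entry of the matrix, the second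
condition makes `-sin (φ / 2)` agree with it in sign, as conjugation in `SL(2, ℝ)` requires. -/
theorem exists_cos_half_eq {T c : ℝ} (h1 : -2 < T) (h2 : T < 2) (hc : c ≠ 0) :
    ∃ φ : ℝ, Real.cos (φ / 2) = T / 2 ∧ Real.sin (φ / 2) * c < 0 := by
  have hsin : 0 < Real.sin (Real.arccos (T / 2)) := by
    rw [Real.sin_arccos]
    apply Real.sqrt_pos.mpr
    nlinarith
  have hcos : Real.cos (Real.arccos (T / 2)) = T / 2 :=
    Real.cos_arccos (by linarith) (by linarith)
  rcases hc.lt_or_gt with h | h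
  · refine ⟨2 * Real.arccos (T / 2), ?_, ?_⟩ <;> rw [mul_div_cancel_left₀ _ two_ne_zero]
    · exact hcos
    · exact mul_neg_of_pos_of_neg hsin h
  · refine ⟨2 * -Real.arccos (T / 2), ?_, ?_⟩ <;> rw [mul_div_cancel_left₀ _ two_ne_zero]
    · rwa [Real.cos_neg]
    · rw [Real.sin_neg]
      exact mul_neg_of_neg_of_pos (neg_neg_of_pos hsin) h

theorem exists_conj_rotationSL {A : SL(2, ℝ)} (h1 : -2 < A.1.trace) (h2 : A.1.trace < 2) :
    ∃ P φ, A = P * rotationSL φ * P⁻¹ := by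
  rw [trace_eq] at h1 h2
  have hdet := det_eq_one A
  have hc : A 1 0 ≠ 0 := by
    intro h
    rw [h, mul_zero, sub_zero] at hdet
    nlinarith [sq_nonneg (A 0 0 - A 1 1)]
  obtain ⟨φ, hC, hS⟩ := exists_cos_half_eq h1 h2 hc
  have hCS := Real.sin_sq_add_cos_sq (φ / 2)
  set C := Real.cos (φ / 2) with hCdef
  set S := Real.sin (φ / 2) with hSdef
  have hS0 : S ≠ 0 := by
    intro h
    simp [h] at hS
  have hpos : 0 < -S / A 1 0 := by
    rw [← mul_div_mul_right _ _ hc]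
    exact div_pos (by linarith) (mul_self_pos.mpr hc)
  have hx := Real.sqrt_pos.mpr hpos
  have hxx := Real.sq_sqrt hpos.le
  set x := √(-S / A 1 0)
  have hcx : A 1 0 * x ^ 2 = -S := by
    rw [hxx]
    field_simp
  -- This upper triangular matrix carries `i` to the fixed point of `A` in the upper half plane,
  -- whose imaginary part is `x ^ 2 = -S / A 1 0`.
  let P : SL(2, ℝ) := ⟨!![x, x * (C - A 0 0) / S; 0, x⁻¹], by
    rw [Matrix.det_fin_two_of]
    field_simp
    ring⟩
  refine ⟨P, φ, eq_mul_inv_of_mul_eq (Subtype.ext ?_)⟩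
  rw [Matrix.SpecialLinearGroup.coe_mul, Matrix.SpecialLinearGroup.coe_mul]
  have hA : A.1 = !![A 0 0, A 0 1; A 1 0, A 1 1] := Matrix.eta_fin_two _
  rw [hA]
  have hT : A 1 1 = 2 * C - A 0 0 := by linarith
  rw [hT] at hdet ⊢
  simp only [P, rotationSL, ← hCdef, ← hSdef]
  generalize A 0 0 = a at *
  generalize A 0 1 = b at *
  generalize A 1 0 = c at *
  ext i j
  fin_cases i <;> fin_cases j <;> simp <;> field_simp
  · ring
  · exact mul_left_cancel₀ hc (by
      linear_combination (a * (C - a) - S ^ 2 - C * (C - a)) * hcx - S * hdet + S * hCS)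
  · linear_combination hcx
  · linear_combination (C - a) * hcx

/-! ### The action of model elements on the line -/

theorem lineAct_rotation (φ x : ℝ) :
    lineAct (flowLift rotationFlow rotationFlow_zero 1 φ) x = x + φ / (2 * Real.pi) := by
  refine (lineAct_mk _ (f := fun t => x + t * φ / (2 * Real.pi)) (by fun_prop) (by simp)
    fun t => ⟨1, one_pos, ?_⟩).trans (by simp)
  simp [rotationFlow, planeAct_rotationSL]

theorem lineAct_fullTurn_zpow_mul (n : ℤ) (a : SLTilde) (x : ℝ) :
    lineAct (fullTurn ^ n * a) x = lineAct a x + n := by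
  have := Real.pi_ne_zero
  rw [map_mul, CircleDeg1Lift.mul_apply, fullTurn_zpow, lineAct_rotation,
    mul_div_cancel_right₀ _ (by positivity)]

theorem lineAct_dilation_zero (d : ℝ) :
    lineAct (flowLift dilationFlow dilationFlow_zero 1 d) 0 = 0 := by
  refine lineAct_mk _ (f := fun _ => 0) continuous_const rfl
    fun t => ⟨Real.exp (t * d / 2), Real.exp_pos _, ?_⟩
  apply Complex.ext <;>
    simp [planeAct, dilationFlow, coe_dilationSL, direction_zero, -Complex.ofReal_exp]

theorem lineAct_shift_zero (s : ℝ) :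
    lineAct (flowLift shiftFlow shiftFlow_zero 1 s) 0 = 0 := by
  refine lineAct_mk _ (f := fun _ => 0) continuous_const rfl fun t => ⟨1, one_pos, ?_⟩
  apply Complex.ext <;> simp [planeAct, shiftFlow, coe_shiftSL, direction_zero]

/-- Fixing `0` means fixing every integer, so by monotonicity no point passes the next integer. -/
theorem lineAct_lt_add_one {a : SLTilde} (h : lineAct a 0 = 0) (x : ℝ) :
    lineAct a x < x + 1 := by
  have h1 := (lineAct a).map_le_of_map_zero x
  rw [h, zero_add] at h1
  exact h1.trans_lt (Int.ceil_lt_add_one x)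

theorem sub_one_lt_lineAct {a : SLTilde} (h : lineAct a 0 = 0) (x : ℝ) :
    x - 1 < lineAct a x := by
  have h1 := (lineAct a).monotone (Int.floor_le x)
  rw [CircleDeg1Lift.map_int_of_map_zero, h, zero_add] at h1
  exact (Int.sub_one_lt_floor x).trans_le h1

/-- The direction of motion of a parabolic: the sine of the angle moved has the sign of `s`. -/
theorem exists_sin_lineAct_shift (s x : ℝ) : ∃ r : ℝ, 0 < r ∧
    r * Real.sin (Real.pi * (lineAct (flowLift shiftFlow shiftFlow_zero 1 s) x - x)) =
      s * Real.sin (Real.pi * x) ^ 2 := by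
  have h := direction_lineAct (flowLift shiftFlow shiftFlow_zero 1 s) x
  generalize lineAct (flowLift shiftFlow shiftFlow_zero 1 s) x = y at h ⊢
  obtain ⟨r, hr, e⟩ := circleAct_eq_iff.mp h.symm
  refine ⟨r, hr, ?_⟩
  have h1 := congrArg Complex.re e
  have h2 := congrArg Complex.im e
  rw [proj_flowLift, one_mul, inv_one, mul_one] at h1 h2
  simp [planeAct, shiftFlow, coe_shiftSL, direction_re, direction_im] at h1 h2
  rw [mul_sub, Real.sin_sub]
  -- This is the determinant of the direction vector and its image under the shift.
  linear_combination Real.sin (Real.pi * x) * h1 - Real.cos (Real.pi * x) * h2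

/-- The displacement lies in `(-1, 1)`, where the sine of `π` times it detects its sign. -/
theorem le_lineAct_shift {s : ℝ} (hs : 0 ≤ s) (x : ℝ) :
    x ≤ lineAct (flowLift shiftFlow shiftFlow_zero 1 s) x := by
  obtain ⟨r, hr, e⟩ := exists_sin_lineAct_shift s x
  by_contra! h
  have h1 := sub_one_lt_lineAct (lineAct_shift_zero s) x
  have h2 := Real.pi_pos
  have h3 := Real.sin_neg_of_neg_of_neg_pi_lt
    (x := Real.pi * (lineAct (flowLift shiftFlow shiftFlow_zero 1 s) x - x))
    (by nlinarith) (by nlinarith)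
  have h4 := mul_neg_of_pos_of_neg hr h3
  rw [e] at h4
  exact absurd h4 (not_lt.mpr (by positivity))

theorem lineAct_shift_le {s : ℝ} (hs : s ≤ 0) (x : ℝ) :
    lineAct (flowLift shiftFlow shiftFlow_zero 1 s) x ≤ x := by
  obtain ⟨r, hr, e⟩ := exists_sin_lineAct_shift s x
  by_contra! h
  have h1 := lineAct_lt_add_one (lineAct_shift_zero s) x
  have h2 := Real.pi_pos
  have h3 := Real.sin_pos_of_pos_of_lt_pi
    (x := Real.pi * (lineAct (flowLift shiftFlow shiftFlow_zero 1 s) x - x))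
    (by nlinarith) (by nlinarith)
  have h4 := mul_pos hr h3
  rw [e] at h4
  exact absurd h4 (not_lt.mpr (mul_nonpos_of_nonpos_of_nonneg hs (sq_nonneg _)))

/-! ### Commutators -/

/-- A commutator over `± P g(x) P⁻¹` is a power of the full turn times the flow lift of this
element, and the power is bounded by the action on the line. -/
theorem exists_commutator_eq (g : C(ℝ, SL(2, ℝ))) (hg : g 0 = 1) {a b : SLTilde} {P : SL(2, ℝ)}
    {x : ℝ} (h : UnivCover.proj ⁅a, b⁆ = P * g x * P⁻¹ ∨
      -UnivCover.proj ⁅a, b⁆ = P * g x * P⁻¹) :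
    ∃ n : ℤ, ⁅a, b⁆ = fullTurn ^ n * flowLift g hg P x ∧
      (∃ y, lineAct (flowLift g hg 1 x) y + n < y + 1) ∧
      ∃ y, y - 1 < lineAct (flowLift g hg 1 x) y + n := by
  have hP := proj_flowLift g hg P x
  obtain ⟨n, hn⟩ := exists_eq_fullTurn_zpow (x := ⁅a, b⁆ * (flowLift g hg P x)⁻¹) (by
    rw [map_mul, map_inv, hP]
    rcases h with h | h
    · left
      rw [h, mul_inv_cancel]
    · right
      rw [← h, inv_neg, mul_neg, mul_inv_cancel])
  have hc : ⁅a, b⁆ = fullTurn ^ n * flowLift g hg P x := mul_inv_eq_iff_eq_mul.mp hn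
  refine ⟨n, hc, ?_⟩
  obtain ⟨p, rfl⟩ := proj_surjective P
  -- Conjugating by a lift of `P` again gives a commutator, and `z` is central, so the displacement
  -- bounds apply to the unconjugated model.
  have hm : ⁅p⁻¹ * a * p⁻¹⁻¹, p⁻¹ * b * p⁻¹⁻¹⁆ = fullTurn ^ n * flowLift g hg 1 x := by
    rw [← conjugate_commutatorElement, hc, ← conj_flowLift, ← mul_assoc, ← mul_assoc,
      ← mul_assoc, ((commute_fullTurn p⁻¹).zpow_right n).eq]
    group
  simp only [← lineAct_fullTurn_zpow_mul, ← hm]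
  exact ⟨exists_lineAct_commutator_lt _ _, exists_lt_lineAct_commutator _ _⟩

theorem trace_proj_fullTurn_zpow_mul {n : ℤ} (hn : n = -1 ∨ n = 1) (a : SLTilde) :
    (UnivCover.proj (fullTurn ^ n * a)).1.trace = -(UnivCover.proj a).1.trace := by
  have : (-1 : SL(2, ℝ))⁻¹ = -1 := by rw [inv_neg, inv_one]
  rw [map_mul, map_zpow, proj_fullTurn]
  rcases hn with rfl | rfl <;>
    simp [this, Matrix.trace_neg]

/-- The model and the commutator bound each contribute less than `1`, whence `|n| < 2`. -/
theorem int_cases_of_fixed {a : SLTilde} (h : lineAct a 0 = 0) {n : ℤ}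
    (h1 : ∃ y, lineAct a y + n < y + 1) (h2 : ∃ y, y - 1 < lineAct a y + n) :
    n = 0 ∨ n = -1 ∨ n = 1 := by
  obtain ⟨y, hy⟩ := h1
  obtain ⟨w, hw⟩ := h2
  have h3 := sub_one_lt_lineAct h y
  have h4 := lineAct_lt_add_one h w
  have h5 : (n : ℝ) < 2 := by linarith
  have h6 : (-2 : ℝ) < n := by linarith
  have h7 : n < 2 := by exact_mod_cast h5
  have h8 : -2 < n := by exact_mod_cast h6
  omega

theorem trace_dilationSL (d : ℝ) : 2 ≤ (dilationSL d).1.trace := by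
  rw [coe_dilationSL, Matrix.trace_fin_two_of]
  have := Real.one_le_cosh (d / 2)
  rw [Real.cosh_eq] at this
  linarith

theorem trace_shiftSL (s : ℝ) : (shiftSL s).1.trace = 2 := by
  rw [coe_shiftSL, Matrix.trace_fin_two_of]
  norm_num

theorem commutator_of_two_lt_trace {a b : SLTilde} (h : 2 < (UnivCover.proj ⁅a, b⁆).1.trace) :
    ∃ P d, 0 < d ∧ ⁅a, b⁆ = flowLift dilationFlow dilationFlow_zero P d := by
  obtain ⟨P, d, hd, e⟩ := exists_conj_dilationSL h
  obtain ⟨n, hn, h1, h2⟩ := exists_commutator_eq dilationFlow dilationFlow_zero (.inl e)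
  refine ⟨P, d, hd, ?_⟩
  rcases int_cases_of_fixed (lineAct_dilation_zero d) h1 h2 with rfl | h3
  · simpa using hn
  · rw [hn, trace_proj_fullTurn_zpow_mul h3, proj_flowLift, trace_conj] at h
    have := trace_dilationSL d
    exact absurd h (not_lt.mpr (by
      change -(dilationSL d).1.trace ≤ 2
      linarith))

theorem commutator_of_trace_lt_neg_two {a b : SLTilde}
    (h : (UnivCover.proj ⁅a, b⁆).1.trace < -2) :
    ∃ n : ℤ, (n = -1 ∨ n = 1) ∧ ∃ P d, 0 < d ∧
      ⁅a, b⁆ = fullTurn ^ n * flowLift dilationFlow dilationFlow_zero P d := by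
  obtain ⟨P, d, hd, e⟩ := exists_conj_dilationSL (A := -UnivCover.proj ⁅a, b⁆) (by
    rw [Matrix.SpecialLinearGroup.coe_neg, Matrix.trace_neg]
    linarith)
  obtain ⟨n, hn, h1, h2⟩ := exists_commutator_eq dilationFlow dilationFlow_zero (.inr e)
  refine ⟨n, ?_, P, d, hd, hn⟩
  rcases int_cases_of_fixed (lineAct_dilation_zero d) h1 h2 with rfl | h3
  · rw [hn, zpow_zero, one_mul, proj_flowLift, trace_conj] at h
    have := trace_dilationSL d
    exact absurd h (not_lt.mpr (by
      change -2 ≤ (dilationSL d).1.trace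
      linarith))
  · exact h3

theorem commutator_of_trace_eq_two {a b : SLTilde} (h : (UnivCover.proj ⁅a, b⁆).1.trace = 2) :
    ∃ P s, ⁅a, b⁆ = flowLift shiftFlow shiftFlow_zero P s := by
  obtain ⟨P, s, e⟩ := exists_conj_shiftSL h
  obtain ⟨n, hn, h1, h2⟩ := exists_commutator_eq shiftFlow shiftFlow_zero (.inl e)
  refine ⟨P, s, ?_⟩
  rcases int_cases_of_fixed (lineAct_shift_zero s) h1 h2 with rfl | h3
  · simpa using hn
  · rw [hn, trace_proj_fullTurn_zpow_mul h3, proj_flowLift, trace_conj] at h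
    have h4 : -(shiftSL s).1.trace = 2 := h
    rw [trace_shiftSL] at h4
    norm_num at h4

theorem commutator_of_trace_eq_neg_two {a b : SLTilde}
    (h : (UnivCover.proj ⁅a, b⁆).1.trace = -2) :
    ∃ (n : ℤ) (P : _) (s : ℝ), (n = -1 ∧ 0 < s ∨ n = 1 ∧ s < 0) ∧
      ⁅a, b⁆ = fullTurn ^ n * flowLift shiftFlow shiftFlow_zero P s := by
  obtain ⟨P, s, e⟩ := exists_conj_shiftSL (A := -UnivCover.proj ⁅a, b⁆) (by
    rw [Matrix.SpecialLinearGroup.coe_neg, Matrix.trace_neg]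
    linarith)
  obtain ⟨n, hn, h1, h2⟩ := exists_commutator_eq shiftFlow shiftFlow_zero (.inr e)
  refine ⟨n, P, s, ?_, hn⟩
  rcases int_cases_of_fixed (lineAct_shift_zero s) h1 h2 with rfl | rfl | rfl
  · rw [hn, zpow_zero, one_mul, proj_flowLift, trace_conj] at h
    have h4 : (shiftSL s).1.trace = -2 := h
    rw [trace_shiftSL] at h4
    norm_num at h4
  · left
    refine ⟨rfl, ?_⟩
    -- With `s ≤ 0` and `n = -1` every point would move back by at least `1`.
    by_contra! hs
    obtain ⟨y, hy⟩ := h2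
    have := lineAct_shift_le hs y
    push_cast at hy
    linarith
  · right
    refine ⟨rfl, ?_⟩
    by_contra! hs
    obtain ⟨y, hy⟩ := h1
    have := le_lineAct_shift hs y
    push_cast at hy
    linarith

/-- The power of `z` is absorbed into the angle; the uniform displacement, angle over `2π`, then has
absolute value below `1`. -/
theorem commutator_of_abs_trace_lt_two {a b : SLTilde}
    (h1 : -2 < (UnivCover.proj ⁅a, b⁆).1.trace) (h2 : (UnivCover.proj ⁅a, b⁆).1.trace < 2) :
    ∃ P φ, -(2 * Real.pi) < φ ∧ φ ≠ 0 ∧ φ < 2 * Real.pi ∧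
      ⁅a, b⁆ = flowLift rotationFlow rotationFlow_zero P φ := by
  obtain ⟨P, φ, e⟩ := exists_conj_rotationSL h1 h2
  obtain ⟨n, hn, ⟨y, hy⟩, ⟨w, hw⟩⟩ :=
    exists_commutator_eq rotationFlow rotationFlow_zero (.inl e)
  have hπ : 0 < 2 * Real.pi := by positivity
  rw [lineAct_rotation] at hy hw
  have e1 : φ / (2 * Real.pi) + n = (n * (2 * Real.pi) + φ) / (2 * Real.pi) := by
    field_simp
    ring
  have hlt : (n * (2 * Real.pi) + φ) / (2 * Real.pi) < 1 := by linarith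
  have hgt : -1 < (n * (2 * Real.pi) + φ) / (2 * Real.pi) := by linarith
  rw [div_lt_one hπ] at hlt
  rw [lt_div_iff₀ hπ] at hgt
  have hc : ⁅a, b⁆ = flowLift rotationFlow rotationFlow_zero P (n * (2 * Real.pi) + φ) := by
    obtain ⟨p, rfl⟩ := proj_surjective P
    rw [hn, ← conj_flowLift, ← conj_flowLift, ← fullTurn_zpow_mul_rotation, ← mul_assoc,
      ← mul_assoc, ← mul_assoc, ((commute_fullTurn p).zpow_right n).eq]
  refine ⟨P, n * (2 * Real.pi) + φ, by linarith, fun h0 => ?_, hlt, hc⟩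
  -- Angle `0` would make the commutator trivial, with trace `2`.
  rw [hc, h0, flowLift_zero, map_one] at h2
  simp at h2

end

theorem mainTheorem6 (α β : PSL(2, ℝ)) (a b : PSLTilde)
    (ha : UnivCover.proj a = α) (hb : UnivCover.proj b = β) :
    (2 < traceTilde ⁅a, b⁆ → ⁅a, b⁆ ∈ Hyp 0) ∧
    (traceTilde ⁅a, b⁆ = 2 → ⁅a, b⁆ ∈ {1} ∪ Par 0) ∧
    (traceTilde ⁅a, b⁆ ∈ Set.Ioo (-2 : ℝ) 2 → ⁅a, b⁆ ∈ EllMinusOne ∪ EllPlusOne) ∧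
    (traceTilde ⁅a, b⁆ = -2 → ⁅a, b⁆ ∈ ParPlus (-1) ∪ ParMinus 1) ∧
    (traceTilde ⁅a, b⁆ < -2 → ⁅a, b⁆ ∈ Hyp (-1) ∪ Hyp 1) := by
  obtain ⟨a, rfl⟩ := coverMap_surjective a
  obtain ⟨b, rfl⟩ := coverMap_surjective b
  rw [← map_commutatorElement, traceTilde, toSL_coverMap]
  refine ⟨fun h => ?_, fun h => ?_, fun h => ?_, fun h => ?_, fun h => ?_⟩
  · obtain ⟨P, d, hd, e⟩ := commutator_of_two_lt_trace h
    exact ⟨P, d, hd, by rw [e, coverMap_flowLift_dilation, zpow_zero, one_mul]⟩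
  · obtain ⟨P, s, e⟩ := commutator_of_trace_eq_two h
    rw [e]
    -- The degenerate shift `s = 0` accounts for the identity.
    rcases lt_trichotomy s 0 with hs | rfl | hs
    · exact .inr (.inr ⟨P, s, hs, by rw [coverMap_flowLift_shift, zpow_zero, one_mul]⟩)
    · left
      rw [flowLift_zero, map_one]
      rfl
    · exact .inr (.inl ⟨P, s, hs, by rw [coverMap_flowLift_shift, zpow_zero, one_mul]⟩)
  · obtain ⟨P, φ, h1, h0, h2, e⟩ := commutator_of_abs_trace_lt_two h.1 h.2
    rw [e, coverMap_flowLift_rotation]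
    rcases h0.lt_or_gt with h0 | h0
    · exact .inl ⟨P, φ, h1, h0, rfl⟩
    · exact .inr ⟨P, φ, h0, h2, rfl⟩
  · obtain ⟨n, P, s, hns, e⟩ := commutator_of_trace_eq_neg_two h
    rw [e, map_mul, map_zpow, coverMap_fullTurn, coverMap_flowLift_shift]
    rcases hns with ⟨rfl, hs⟩ | ⟨rfl, hs⟩
    · exact .inl ⟨P, s, hs, rfl⟩
    · exact .inr ⟨P, s, hs, rfl⟩
  · obtain ⟨n, hn, P, d, hd, e⟩ := commutator_of_trace_lt_neg_two h
    rw [e, map_mul, map_zpow, coverMap_fullTurn, coverMap_flowLift_dilation]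
    rcases hn with rfl | rfl
    · exact .inl ⟨P, d, hd, rfl⟩
    · exact .inr ⟨P, d, hd, rfl⟩
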